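/- Let $\Omega$ be a set and $\mathcal H$ a linear space of real functions on $\Omega$ such that $\varphi(X_1,\dots,X_n)\in\mathcal H$ whenever $X_1,\dots,X_n\in\mathcal H$ and $\varphi:\mathbb R^n\to\mathbb R$ is Lipschitz. Let $\hat{\mathbb E}:\mathcal H\to\mathbb R$ be a sublinear expectation, i.e. a functional that is monotone, constant preserving ($\hat{\mathbb E}[c]=c$), sub-additive, and positively homogeneous. We call $(\Omega,\mathcal H,\hat{\mathbb E})$ a sublinear expectation space and the elements of $\mathcal H$ its random variables. Random variables $X,Y$, possibly on different sublinear expectation spaces, are identically distributed, $X\overset{d}{=}Y$, if $\hat{\mathbb E}[\varphi(X)]=\hat{\mathbb E}'[\varphi(Y)]$ for all Lipschitz $\varphi:\mathbb R\to\mathbb R$, where each expectation is that of the respective space. On one space, $Y$ is independent of $X$ if $\hat{\mathbb E}[\varphi(X,Y)]=\hat{\mathbb E}\big[\hat{\mathbb E}[\varphi(x,Y)]_{x=X}\big]$ for all Lipschitz $\varphi:\mathbb R^2\to\mathbb R$; an independent copy of $X$ is a random variable $\bar X$ on the same space that is independent of $X$ and satisfies $\bar X\overset{d}{=}X$. A random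 variable $X$ is maximally distributed if there is a bounded, closed, convex set $\Lambda\subset\mathbb R$ with $\hat{\mathbb E}[\varphi(X)]=\max_{x\in\Lambda}\varphi(x)$ (the maximum being attained) for all Lipschitz $\varphi:\mathbb R\to\mathbb R$. It is uniformly integrable if $\lim_{\lambda\to\infty}\hat{\mathbb E}[(|X|-\lambda)^+]=0$. **Corollary.** Let $X$ be a uniformly integrable random variable on a sublinear expectation space $(\Omega,\mathcal H,\hat{\mathbb E})$. Then: 1. There are a sublinear expectation space over $\mathbb R^2$ and random variables $X_1,\bar X$ on it such that $X_1\overset{d}{=}X$ and $\bar X$ is an independent copy of $X_1$. 2. If $\bar X$ is an independent copy of $X$ on $(\Omega,\mathcal H,\hat{\mathbb E})$, then $X$ is maximally distributed if and only if $X+\bar X\overset{d}{=}2X$. 3. More generally, if $X_1\overset{d}{=}X$ is a random variable on any sublinear expectation space and $\bar X$ is an independent copy of $X_1$ on that space, then $X$ is maximally distributed if and only if $X_1+\bar X\overset{d}{=}2X$. -/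

import Mathlib

open Filter Topology

/-- `φ` is Lipschitz for some constant. On the finite-dimensional spaces `Fin n → ℝ` and `ℝ × ℝ`
this class does not depend on the choice of the (equivalent) norm. -/
def IsLip {α β : Type*} [PseudoEMetricSpace α] [PseudoEMetricSpace β] (φ : α → β) : Prop :=
  ∃ K : NNReal, LipschitzWith K φ

/-- A sublinear expectation space `(Ω, H, E)`: `H` is a linear space of real functions on `Ω` that
is stable under composition with Lipschitz functions of finitely many variables, and `E` is a
sublinear expectation on `H`. The functional `E` is written as a function on all of `Ω → ℝ`, but
it carries information on `H` only: nothing is required or used outside `H`. -/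
structure SublinearExpectationSpace (Ω : Type*) where
  H : Submodule ℝ (Ω → ℝ)
  comp_mem : ∀ (n : ℕ) (X : Fin n → Ω → ℝ), (∀ i, X i ∈ H) →
    ∀ φ : (Fin n → ℝ) → ℝ, IsLip φ → (fun ω => φ (fun i => X i ω)) ∈ H
  E : (Ω → ℝ) → ℝ
  mono : ∀ X ∈ H, ∀ Y ∈ H, (∀ ω, Y ω ≤ X ω) → E Y ≤ E X
  const : ∀ c : ℝ, E (fun _ => c) = c
  subadd : ∀ X ∈ H, ∀ Y ∈ H, E (X + Y) ≤ E X + E Y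
  pos_homog : ∀ X ∈ H, ∀ r : ℝ, 0 ≤ r → E (r • X) = r * E X

namespace SublinearExpectationSpace

variable {Ω Ω' : Type*}

/-- Uniform integrability of `X` under `E`: `E[(|X| - t)⁺] → 0` as `t → ∞`. -/
def UniformlyIntegrable (S : SublinearExpectationSpace Ω) (X : Ω → ℝ) : Prop :=
  Tendsto (fun t : ℝ => S.E (fun ω => max (|X ω| - t) 0)) atTop (𝓝 0)

/-- `X` (under `S`) and `Y` (under `S'`) have the same sublinear distribution. -/
def IdentDistrib (S : SublinearExpectationSpace Ω) (X : Ω → ℝ)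
    (S' : SublinearExpectationSpace Ω') (Y : Ω' → ℝ) : Prop :=
  ∀ φ : ℝ → ℝ, IsLip φ → S.E (fun ω => φ (X ω)) = S'.E (fun ω => φ (Y ω))

/-- `Y` is independent of `X`: `E[φ(X, Y)] = E[E[φ(x, Y)]_{x = X}]` for all Lipschitz `φ`.
The order matters, since this relation is not symmetric. -/
def IndepOf (S : SublinearExpectationSpace Ω) (Y X : Ω → ℝ) : Prop :=
  ∀ φ : ℝ × ℝ → ℝ, IsLip φ →
    S.E (fun ω => φ (X ω, Y ω)) = S.E (fun ω => S.E (fun ω' => φ (X ω, Y ω')))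

/-- `Y` is an independent copy of `X`. -/
def IsIndepCopy (S : SublinearExpectationSpace Ω) (Y X : Ω → ℝ) : Prop :=
  S.IndepOf Y X ∧ S.IdentDistrib Y S X

/-- `X` is maximally distributed: for some bounded closed convex `Λ ⊆ ℝ`, for every Lipschitz `φ`,
`E[φ(X)]` is the maximum of `φ` over `Λ` (attained, so that `Λ` is nonempty). -/
def MaximallyDistributed (S : SublinearExpectationSpace Ω) (X : Ω → ℝ) : Prop :=
  ∃ Λ : Set ℝ, Bornology.IsBounded Λ ∧ IsClosed Λ ∧ Convex ℝ Λ ∧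
    ∀ φ : ℝ → ℝ, IsLip φ → IsGreatest (φ '' Λ) (S.E (fun ω => φ (X ω)))

/-! The following facts show that every function to which `E` is applied above lies in `H`. -/

theorem comp_mem_one (S : SublinearExpectationSpace Ω) {X : Ω → ℝ} (hX : X ∈ S.H)
    {φ : ℝ → ℝ} (hφ : IsLip φ) : (fun ω => φ (X ω)) ∈ S.H := by
  obtain ⟨K, hK⟩ := hφ
  exact S.comp_mem 1 (fun _ => X) (fun _ => hX) (fun v => φ (v 0))
    ⟨K * 1, hK.comp (LipschitzWith.eval (α := fun _ : Fin 1 => ℝ) 0)⟩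

theorem comp_mem_two (S : SublinearExpectationSpace Ω) {X Y : Ω → ℝ} (hX : X ∈ S.H)
    (hY : Y ∈ S.H) {φ : ℝ × ℝ → ℝ} (hφ : IsLip φ) : (fun ω => φ (X ω, Y ω)) ∈ S.H := by
  obtain ⟨K, hK⟩ := hφ
  have h := S.comp_mem 2 ![X, Y] (fun i => by fin_cases i <;> simpa) (fun v => φ (v 0, v 1))
    ⟨_, hK.comp ((LipschitzWith.eval (α := fun _ : Fin 2 => ℝ) 0).prodMk
      (LipschitzWith.eval (α := fun _ : Fin 2 => ℝ) 1))⟩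
  simpa using h

theorem section_mem (S : SublinearExpectationSpace Ω) {Y : Ω → ℝ} (hY : Y ∈ S.H)
    {φ : ℝ × ℝ → ℝ} (hφ : IsLip φ) (x : ℝ) : (fun ω => φ (x, Y ω)) ∈ S.H := by
  obtain ⟨K, hK⟩ := hφ
  exact S.comp_mem_one hY (φ := fun y => φ (x, y)) ⟨_, hK.comp (LipschitzWith.prodMk_left x)⟩

theorem const_mem (S : SublinearExpectationSpace Ω) (c : ℝ) : (fun _ => c) ∈ S.H :=
  S.comp_mem_one S.H.zero_mem (φ := fun _ => c) ⟨0, LipschitzWith.const c⟩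

theorem isLip_section (S : SublinearExpectationSpace Ω) {Y : Ω → ℝ} (hY : Y ∈ S.H)
    {φ : ℝ × ℝ → ℝ} (hφ : IsLip φ) : IsLip (fun x => S.E (fun ω => φ (x, Y ω))) := by
  have hφ' := hφ
  obtain ⟨K, hK⟩ := hφ
  refine ⟨K, LipschitzWith.of_le_add_mul K fun x y => ?_⟩
  have h1 := S.section_mem hY hφ' y
  have h2 := S.const_mem (K * dist x y)
  have h3 := S.subadd _ h1 _ h2
  rw [S.const] at h3
  refine le_trans (S.mono _ (S.H.add_mem h1 h2) _ (S.section_mem hY hφ' x) fun ω => ?_) h3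
  have h4 := hK.dist_le_mul (x, Y ω) (y, Y ω)
  have h5 := le_abs_self (φ (x, Y ω) - φ (y, Y ω))
  rw [Prod.dist_eq, dist_self, max_eq_left dist_nonneg, Real.dist_eq, Real.dist_eq] at h4
  simp only [Pi.add_apply, Real.dist_eq]
  linarith

theorem iterated_mem (S : SublinearExpectationSpace Ω) {X Y : Ω → ℝ} (hX : X ∈ S.H)
    (hY : Y ∈ S.H) {φ : ℝ × ℝ → ℝ} (hφ : IsLip φ) :
    (fun ω => S.E (fun ω' => φ (X ω, Y ω'))) ∈ S.H :=
  S.comp_mem_one hX (S.isLip_section hY hφ)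

end SublinearExpectationSpace

/-! Independence together with equality in law eliminates the copy: the identity to study is
`IsDoubling`, which involves `X` alone. If `X` is maximal over a convex `Λ`, doubling holds because
sums of two points of `Λ` are exactly the doubles of points of `Λ`.

Conversely, put `a = -E[-X]`, `b = E[X]`. Maximality over `[a, b]` follows from three estimates:
`E[(X - b)⁺] ≤ 0`, `E[(a - X)⁺] ≤ 0`, and `E[-|X - y|] ≥ 0` for `y ∈ [a, b]`. A Lipschitz `φ`
differs from its value at the projection onto `[a, b]`, or at its maximum point, by at most a
multiple of these quantities.

Each estimate is a law of large numbers in disguise. Doubling turns a bound `E[f(x + hY)] ≤ f(x) +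
c`, uniform in `x`, into the same bound with `2h` and `2c`. Starting at `h = 2⁻ⁿ`, an error `o(h)`
vanishes after `n` doublings (`IsDoubling.expect_le`, `IsDoubling.le_expect`). The `o(h)` error
comes from expanding `√(x² + d²)` to first order: the mean condition gives the linear term its sign,
and uniform integrability controls the remainder. -/

theorem isLip_of_abs_sub_le {f : ℝ → ℝ} (K : ℝ) (h : ∀ x y, |f x - f y| ≤ K * |x - y|) :
    IsLip f := by
  refine ⟨K.toNNReal, LipschitzWith.of_dist_le_mul fun x y => ?_⟩
  rw [Real.dist_eq, Real.dist_eq]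
  exact (h x y).trans (mul_le_mul_of_nonneg_right (Real.le_coe_toNNReal K) (abs_nonneg _))

theorem IsLip.exists_abs_sub_le {f : ℝ → ℝ} (hf : IsLip f) :
    ∃ K : ℝ, 0 ≤ K ∧ ∀ x y, |f x - f y| ≤ K * |x - y| := by
  obtain ⟨K, hK⟩ := hf
  exact ⟨K, K.2, fun x y => by simpa [Real.dist_eq] using hK.dist_le_mul x y⟩

theorem IsLip.comp {α β γ : Type*} [PseudoEMetricSpace α] [PseudoEMetricSpace β]
    [PseudoEMetricSpace γ] {g : β → γ} {f : α → β} (hg : IsLip g) (hf : IsLip f) :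
    IsLip (fun x => g (f x)) := by
  obtain ⟨K, hK⟩ := hg
  obtain ⟨L, hL⟩ := hf
  exact ⟨K * L, hK.comp hL⟩

theorem isLip_fst : IsLip (Prod.fst : ℝ × ℝ → ℝ) := ⟨1, LipschitzWith.prod_fst⟩

theorem isLip_snd : IsLip (Prod.snd : ℝ × ℝ → ℝ) := ⟨1, LipschitzWith.prod_snd⟩

theorem isLip_affine (a b : ℝ) : IsLip (fun x : ℝ => a + b * x) :=
  isLip_of_abs_sub_le |b| fun x y => by
    rw [← abs_mul]
    exact le_of_eq (by ring_nf)

theorem isLip_posPart_sub (t : ℝ) : IsLip (fun x : ℝ => max (x - t) 0) :=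
  isLip_of_abs_sub_le 1 fun x y => by
    have := abs_max_sub_max_le_abs (x - t) (y - t) 0
    simpa using this

theorem isLip_abs_sub (c : ℝ) : IsLip (fun x : ℝ => |x - c|) :=
  isLip_of_abs_sub_le 1 fun x y => by
    have := abs_abs_sub_abs_le_abs_sub (x - c) (y - c)
    simpa using this

theorem isLip_add_prod : IsLip (fun p : ℝ × ℝ => p.1 + p.2) :=
  ⟨1 + 1, LipschitzWith.prod_fst.add LipschitzWith.prod_snd⟩

theorem isLip_add {α : Type*} [PseudoEMetricSpace α] {f g : α → ℝ} (hf : IsLip f) (hg : IsLip g) :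
    IsLip (f + g) := by
  obtain ⟨K, hK⟩ := hf
  obtain ⟨L, hL⟩ := hg
  exact ⟨K + L, hK.add hL⟩

theorem isLip_const_smul {α : Type*} [PseudoEMetricSpace α] {f : α → ℝ} (r : ℝ) (hf : IsLip f) :
    IsLip (r • f) := by
  have := (isLip_affine 0 r).comp hf
  simpa [Pi.smul_def] using this

theorem isLip_pi {α : Type*} [PseudoEMetricSpace α] {n : ℕ} {f : Fin n → α → ℝ}
    (hf : ∀ i, IsLip (f i)) : IsLip (fun x i => f i x) := by
  choose K hK using hf
  refine ⟨∑ i, K i, fun x y => ?_⟩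
  refine edist_pi_le_iff.2 fun i => (hK i x y).trans ?_
  gcongr
  exact Finset.single_le_sum (f := K) (fun _ _ => zero_le) (Finset.mem_univ i)

/-! ### Smooth approximation of the absolute value -/

/-- The smooth approximation `√(x² + d²)` of the absolute value. -/
noncomputable def smoothAbs (d x : ℝ) : ℝ := √(x ^ 2 + d ^ 2)

theorem smoothAbs_sq (d x : ℝ) : smoothAbs d x ^ 2 = x ^ 2 + d ^ 2 :=
  Real.sq_sqrt (by positivity)

theorem smoothAbs_nonneg (d x : ℝ) : 0 ≤ smoothAbs d x := Real.sqrt_nonneg _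

theorem abs_le_smoothAbs (d x : ℝ) : |x| ≤ smoothAbs d x :=
  Real.abs_le_sqrt (by nlinarith [sq_nonneg d])

theorem le_smoothAbs (d x : ℝ) : d ≤ smoothAbs d x :=
  (le_abs_self d).trans (Real.abs_le_sqrt (by nlinarith [sq_nonneg x]))

theorem smoothAbs_zero {d : ℝ} (hd : 0 ≤ d) : smoothAbs d 0 = d := by
  simp [smoothAbs, Real.sqrt_sq hd]

theorem smoothAbs_add_le (d x z : ℝ) : smoothAbs d (x + z) ≤ smoothAbs d x + |z| := by
  refine Real.sqrt_le_iff.2 ⟨add_nonneg (smoothAbs_nonneg d x) (abs_nonneg z), ?_⟩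
  have h : x * z ≤ smoothAbs d x * |z| :=
    (le_abs_self _).trans (by
      rw [abs_mul]
      exact mul_le_mul_of_nonneg_right (abs_le_smoothAbs d x) (abs_nonneg z))
  nlinarith [smoothAbs_sq d x, sq_abs z]

theorem isLip_smoothAbs (d : ℝ) : IsLip (smoothAbs d) :=
  isLip_of_abs_sub_le 1 fun x y => by
    have h1 := smoothAbs_add_le d x (y - x)
    have h2 := smoothAbs_add_le d y (x - y)
    rw [add_sub_cancel] at h1 h2
    rw [abs_sub_comm] at h1
    rw [abs_le]
    constructor <;> linarith

theorem abs_div_smoothAbs_le_one {d : ℝ} (hd : 0 < d) (x : ℝ) : |x / smoothAbs d x| ≤ 1 := by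
  have hs : 0 < smoothAbs d x := hd.trans_le (le_smoothAbs d x)
  rw [abs_div, abs_of_pos hs]
  exact (div_le_one hs).2 (abs_le_smoothAbs d x)

/-- With `s`, `t` the values at `x` and `x + z`, this is `2st ≤ s² + t²` divided by `2s`, followed
by `s ≥ d`. -/
theorem smoothAbs_add_le_quadratic {d : ℝ} (hd : 0 < d) (x z : ℝ) :
    smoothAbs d (x + z) ≤ smoothAbs d x + x / smoothAbs d x * z + z ^ 2 / (2 * d) := by
  have hds := le_smoothAbs d x
  have hs : 0 < smoothAbs d x := hd.trans_le hds
  have h1 : z ^ 2 / (2 * smoothAbs d x) ≤ z ^ 2 / (2 * d) := by gcongr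
  have h2 : smoothAbs d (x + z) ≤
      smoothAbs d x + x / smoothAbs d x * z + z ^ 2 / (2 * smoothAbs d x) := by
    have h3 : smoothAbs d x + x / smoothAbs d x * z + z ^ 2 / (2 * smoothAbs d x)
        = (2 * smoothAbs d x ^ 2 + 2 * x * z + z ^ 2) / (2 * smoothAbs d x) := by
      field_simp
    rw [h3, le_div_iff₀ (by positivity)]
    nlinarith [sq_nonneg (smoothAbs d (x + z) - smoothAbs d x), smoothAbs_sq d x,
      smoothAbs_sq d (x + z)]
  linarith

/-- First-order expansion of `smoothAbs` with a remainder that is of order `h²` up to a tail. -/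
theorem smoothAbs_add_mul_le {d h l : ℝ} (hd : 0 < d) (hh : 0 ≤ h) (x y : ℝ) :
    smoothAbs d (x + h * y) ≤ smoothAbs d x + h * (x / smoothAbs d x) * y
      + (2 * h ^ 2 * l ^ 2 / d + 4 * h * max (|y| - l) 0) := by
  -- Small `y` use the quadratic bound. For `|y| ≥ 2l` the increment and the linear term are each at
  -- most `h|y|`, and `|y| ≤ 2(|y| - l)`, whence the factor `4`.
  rcases le_total |y| (2 * l) with hy | hy
  · have h1 := smoothAbs_add_le_quadratic hd x (h * y)
    have h2 : (h * y) ^ 2 / (2 * d) ≤ 2 * h ^ 2 * l ^ 2 / d := by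
      rw [div_le_div_iff₀ (by positivity) hd]
      have : y ^ 2 ≤ (2 * l) ^ 2 := sq_le_sq' (by linarith [neg_abs_le y]) (by linarith [le_abs_self y])
      have h3 := mul_le_mul_of_nonneg_left this (by positivity : 0 ≤ h ^ 2 * d)
      nlinarith
    have h4 : 0 ≤ 4 * h * max (|y| - l) 0 := by positivity
    linarith
  · have h1 := smoothAbs_add_le d x (h * y)
    have h2 : -(h * (x / smoothAbs d x) * y) ≤ h * |y| := by
      refine (neg_le_abs _).trans ?_
      rw [abs_mul, abs_mul, abs_of_nonneg hh]
      have := mul_le_mul_of_nonneg_left (abs_div_smoothAbs_le_one hd x) hh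
      exact mul_le_mul_of_nonneg_right (by linarith) (abs_nonneg y)
    rw [abs_mul, abs_of_nonneg hh] at h1
    have h3 : h * |y| ≤ 2 * h * max (|y| - l) 0 := by
      have : |y| ≤ 2 * max (|y| - l) 0 := by linarith [le_max_left (|y| - l) 0]
      nlinarith
    have h4 : 0 ≤ 2 * h ^ 2 * l ^ 2 / d := by positivity
    linarith

/-! ### Calculus of `E`, doubling and tails -/

namespace SublinearExpectationSpace

variable {Ω Ω' : Type*}

theorem expect_add_const (S : SublinearExpectationSpace Ω) {Z : Ω → ℝ} (hZ : Z ∈ S.H) (c : ℝ) :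
    S.E (fun ω => Z ω + c) = S.E Z + c := by
  have h1 := S.subadd _ hZ _ (S.const_mem c)
  have h2 := S.subadd _ (S.H.add_mem hZ (S.const_mem c)) _ (S.const_mem (-c))
  rw [S.const] at h1 h2
  have h3 : Z + (fun _ => c) + (fun _ => -c) = Z := by ext; simp
  rw [h3] at h2
  exact le_antisymm h1 (by change S.E Z ≤ S.E (fun ω => Z ω + c) + -c at h2; linarith)

theorem expect_neg_add_nonneg (S : SublinearExpectationSpace Ω) {Z : Ω → ℝ} (hZ : Z ∈ S.H) :
    0 ≤ S.E Z + S.E (-Z) := by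
  have h := S.subadd _ hZ _ (S.H.neg_mem hZ)
  rw [add_neg_cancel] at h
  exact (S.const 0).symm.trans_le h

theorem expect_mul_of_nonneg (S : SublinearExpectationSpace Ω) {Z : Ω → ℝ} (hZ : Z ∈ S.H)
    {r : ℝ} (hr : 0 ≤ r) : S.E (fun ω => r * Z ω) = r * S.E Z :=
  S.pos_homog Z hZ r hr

theorem affine_mem (S : SublinearExpectationSpace Ω) {Y : Ω → ℝ} (hY : Y ∈ S.H) (a b : ℝ) :
    (fun ω => a + b * Y ω) ∈ S.H := S.comp_mem_one hY (isLip_affine a b)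

/-- Two independent copies of `Y` add up to `2 * Y` in distribution, expressed by `Y` alone. -/
def IsDoubling (S : SublinearExpectationSpace Ω) (Y : Ω → ℝ) : Prop :=
  ∀ φ : ℝ → ℝ, IsLip φ →
    S.E (fun ω => S.E (fun ω' => φ (Y ω + Y ω'))) = S.E (fun ω => φ (2 * Y ω))

/-- Arbitrarily small tails `E[(|Y| - l)⁺]`. -/
def HasSmallTails (S : SublinearExpectationSpace Ω) (Y : Ω → ℝ) : Prop :=
  ∀ ε > 0, ∃ l : ℝ, S.E (fun ω => max (|Y ω| - l) 0) ≤ ε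

theorem tail_mem (S : SublinearExpectationSpace Ω) {Y : Ω → ℝ} (hY : Y ∈ S.H) (l : ℝ) :
    (fun ω => max (|Y ω| - l) 0) ∈ S.H := by
  have := S.comp_mem_one hY ((isLip_posPart_sub l).comp (isLip_abs_sub 0))
  simpa using this

theorem UniformlyIntegrable.hasSmallTails {S : SublinearExpectationSpace Ω} {X : Ω → ℝ}
    (h : S.UniformlyIntegrable X) : S.HasSmallTails X := fun ε hε => by
  obtain ⟨l, h1⟩ := (h.eventually (gt_mem_nhds hε)).exists
  exact ⟨l, h1.le⟩

theorem HasSmallTails.sub_const {S : SublinearExpectationSpace Ω} {X : Ω → ℝ} (hX : X ∈ S.H)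
    (h : S.HasSmallTails X) (c : ℝ) : S.HasSmallTails (fun ω => X ω - c) := fun ε hε => by
  obtain ⟨l, h2⟩ := h ε hε
  refine ⟨l + |c|, (S.mono _ (S.tail_mem hX l) _ ?_ fun ω => ?_).trans h2⟩
  · exact S.tail_mem (S.H.sub_mem hX (S.const_mem c)) _
  · exact max_le_max (by linarith [abs_sub (X ω) c]) le_rfl

theorem HasSmallTails.neg {S : SublinearExpectationSpace Ω} {X : Ω → ℝ}
    (h : S.HasSmallTails X) : S.HasSmallTails (-X) := by
  simpa [HasSmallTails] using h

/-- Invariance under translation and reflection lets the later estimates be proved around the origin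
only. -/
theorem IsDoubling.affine {S : SublinearExpectationSpace Ω} {X : Ω → ℝ} (h : S.IsDoubling X)
    (a b : ℝ) : S.IsDoubling (fun ω => a + b * X ω) := fun φ hφ => by
  have := h _ (hφ.comp (isLip_affine (2 * a) b))
  convert this using 4
  · ext
    ring_nf
  · ring

theorem IsDoubling.sub_const {S : SublinearExpectationSpace Ω} {X : Ω → ℝ} (h : S.IsDoubling X)
    (c : ℝ) : S.IsDoubling (fun ω => X ω - c) := by
  have := h.affine (-c) 1
  convert this using 2
  ring

theorem IsDoubling.neg {S : SublinearExpectationSpace Ω} {X : Ω → ℝ} (h : S.IsDoubling X) :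
    S.IsDoubling (-X) := by
  have := h.affine 0 (-1)
  convert this using 2
  simp

/-! ### Dyadic iteration of one-step bounds -/

section Iteration

variable {S : SublinearExpectationSpace Ω} {Y : Ω → ℝ} {f : ℝ → ℝ}

theorem shift_mem (hY : Y ∈ S.H) (hf : IsLip f) (x h : ℝ) : (fun ω => f (x + h * Y ω)) ∈ S.H :=
  S.comp_mem_one hY (hf.comp (isLip_affine x h))

theorem iterated_shift_mem (hY : Y ∈ S.H) (hf : IsLip f) (x h : ℝ) :
    (fun ω => S.E fun ω' => f (x + h * Y ω + h * Y ω')) ∈ S.H := by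
  have := S.iterated_mem hY hY (hf.comp ((isLip_affine x h).comp isLip_add_prod))
  convert this using 5
  ring

theorem IsDoubling.expect_shift (hd : S.IsDoubling Y) (hf : IsLip f) (x h : ℝ) :
    S.E (fun ω => f (x + 2 * h * Y ω)) =
      S.E (fun ω => S.E fun ω' => f (x + h * Y ω + h * Y ω')) := by
  have := hd _ (hf.comp (isLip_affine x h))
  convert this.symm using 4
  · ring
  · ext
    ring_nf

/-- A step of size `2h` splits into two independent steps of size `h`; the bound is used once for
the inner expectation and once for the outer. -/
theorem IsDoubling.expect_le_double (hd : S.IsDoubling Y) (hY : Y ∈ S.H) (hf : IsLip f) {h c : ℝ}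
    (hc : ∀ x, S.E (fun ω => f (x + h * Y ω)) ≤ f x + c) (x : ℝ) :
    S.E (fun ω => f (x + 2 * h * Y ω)) ≤ f x + 2 * c := by
  rw [hd.expect_shift hf]
  have hm := shift_mem hY hf x h
  have h1 := S.mono _ (S.H.add_mem hm (S.const_mem c)) _ (iterated_shift_mem hY hf x h)
    fun ω => hc _
  have h2 := S.expect_add_const hm c
  change _ ≤ S.E (fun ω => f (x + h * Y ω) + c) at h1
  linarith [hc x]

theorem IsDoubling.le_expect_double (hd : S.IsDoubling Y) (hY : Y ∈ S.H) (hf : IsLip f) {h c : ℝ}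
    (hc : ∀ x, f x - c ≤ S.E (fun ω => f (x + h * Y ω))) (x : ℝ) :
    f x - 2 * c ≤ S.E (fun ω => f (x + 2 * h * Y ω)) := by
  rw [hd.expect_shift hf]
  have hm := shift_mem hY hf x h
  have h1 := S.mono _ (iterated_shift_mem hY hf x h) _ (S.H.add_mem hm (S.const_mem (-c)))
    fun ω => by simpa [sub_eq_add_neg] using hc _
  have h2 := S.expect_add_const hm (-c)
  change S.E (fun ω => f (x + h * Y ω) + -c) ≤ _ at h1
  linarith [hc x]

theorem IsDoubling.expect_le_of_dyadic (hd : S.IsDoubling Y) (hY : Y ∈ S.H) (hf : IsLip f) (n : ℕ) :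
    ∀ {h c : ℝ}, (∀ x, S.E (fun ω => f (x + h * Y ω)) ≤ f x + c) →
      ∀ x, S.E (fun ω => f (x + 2 ^ n * h * Y ω)) ≤ f x + 2 ^ n * c := by
  induction n with
  | zero => intro h c hc x; simpa using hc x
  | succ n ih =>
    intro h c hc x
    have := ih (hd.expect_le_double hY hf hc) x
    simpa only [pow_succ, mul_assoc] using this

theorem IsDoubling.le_expect_of_dyadic (hd : S.IsDoubling Y) (hY : Y ∈ S.H) (hf : IsLip f) (n : ℕ) :
    ∀ {h c : ℝ}, (∀ x, f x - c ≤ S.E (fun ω => f (x + h * Y ω))) →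
      ∀ x, f x - 2 ^ n * c ≤ S.E (fun ω => f (x + 2 ^ n * h * Y ω)) := by
  induction n with
  | zero => intro h c hc x; simpa using hc x
  | succ n ih =>
    intro h c hc x
    have := ih (hd.le_expect_double hY hf hc) x
    simpa only [pow_succ, mul_assoc] using this

/-- If the one-step error is `o(h)`, uniformly in the starting point, there is no total error. -/
theorem IsDoubling.expect_le (hd : S.IsDoubling Y) (hY : Y ∈ S.H) (hf : IsLip f)
    (hc : ∀ ε > 0, ∃ C : ℝ, ∀ h, 0 ≤ h → ∀ x,
      S.E (fun ω => f (x + h * Y ω)) ≤ f x + (C * h ^ 2 + ε * h)) :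
    S.E (fun ω => f (Y ω)) ≤ f 0 := by
  refine le_of_forall_pos_le_add fun ε hε => ?_
  obtain ⟨C, hC⟩ := hc (ε / 2) (half_pos hε)
  -- With `h = 2⁻ⁿ` the total error is `2ⁿ(C h² + (ε/2) h) = C 2⁻ⁿ + ε/2`, so `n` must make `|C| 2⁻ⁿ
  -- < ε/2`.
  obtain ⟨n, hn⟩ := exists_pow_lt_of_lt_one (by positivity : 0 < ε / 2 / (|C| + 1))
    (by norm_num : (1 / 2 : ℝ) < 1)
  have h1 := hd.expect_le_of_dyadic hY hf n (hC ((1 / 2) ^ n) (by positivity)) 0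
  have h2 : (2 : ℝ) ^ n * (1 / 2) ^ n = 1 := by rw [← mul_pow]; norm_num
  have h3 : (2 : ℝ) ^ n * (C * ((1 / 2) ^ n) ^ 2 + ε / 2 * (1 / 2) ^ n)
      = C * (1 / 2) ^ n + ε / 2 := by
    linear_combination (C * (1 / 2) ^ n + ε / 2) * h2
  rw [h2, h3] at h1
  simp only [one_mul, zero_add] at h1
  rw [lt_div_iff₀ (by positivity)] at hn
  have h4 : C * (1 / 2) ^ n ≤ |C| * (1 / 2) ^ n :=
    mul_le_mul_of_nonneg_right (le_abs_self C) (by positivity)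
  have h5 : (0 : ℝ) < (1 / 2) ^ n := by positivity
  linarith

theorem IsDoubling.le_expect (hd : S.IsDoubling Y) (hY : Y ∈ S.H) (hf : IsLip f)
    (hc : ∀ ε > 0, ∃ C : ℝ, ∀ h, 0 ≤ h → ∀ x,
      f x - (C * h ^ 2 + ε * h) ≤ S.E (fun ω => f (x + h * Y ω))) :
    f 0 ≤ S.E (fun ω => f (Y ω)) := by
  refine le_of_forall_pos_le_add fun ε hε => ?_
  obtain ⟨C, hC⟩ := hc (ε / 2) (half_pos hε)
  obtain ⟨n, hn⟩ := exists_pow_lt_of_lt_one (by positivity : 0 < ε / 2 / (|C| + 1))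
    (by norm_num : (1 / 2 : ℝ) < 1)
  have h1 := hd.le_expect_of_dyadic hY hf n (hC ((1 / 2) ^ n) (by positivity)) 0
  have h2 : (2 : ℝ) ^ n * (1 / 2) ^ n = 1 := by rw [← mul_pow]; norm_num
  have h3 : (2 : ℝ) ^ n * (C * ((1 / 2) ^ n) ^ 2 + ε / 2 * (1 / 2) ^ n)
      = C * (1 / 2) ^ n + ε / 2 := by
    linear_combination (C * (1 / 2) ^ n + ε / 2) * h2
  rw [h2, h3] at h1
  simp only [one_mul, zero_add] at h1
  rw [lt_div_iff₀ (by positivity)] at hn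
  have h4 : C * (1 / 2) ^ n ≤ |C| * (1 / 2) ^ n :=
    mul_le_mul_of_nonneg_right (le_abs_self C) (by positivity)
  have h5 : (0 : ℝ) < (1 / 2) ^ n := by positivity
  linarith

/-- The remainder in the expansion of `smoothAbs` has expectation `o(h)`. -/
theorem HasSmallTails.expect_remainder_le (ht : S.HasSmallTails Y) (hY : Y ∈ S.H) (d : ℝ) {ε : ℝ}
    (hε : 0 < ε) : ∃ l C : ℝ, ∀ h, 0 ≤ h →
      S.E (fun ω => 2 * h ^ 2 * l ^ 2 / d + 4 * h * max (|Y ω| - l) 0) ≤ C * h ^ 2 + ε * h := by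
  obtain ⟨l, hE⟩ := ht (ε / 4) (by positivity)
  refine ⟨l, 2 * l ^ 2 / d, fun h hh => ?_⟩
  have hm := S.tail_mem hY l
  have h1 := S.expect_mul_of_nonneg hm (r := 4 * h) (by positivity)
  have h2 := S.expect_add_const (S.H.smul_mem (4 * h) hm) (2 * h ^ 2 * l ^ 2 / d)
  simp only [Pi.smul_apply, smul_eq_mul, Pi.smul_def] at h2
  simp only [add_comm (2 * h ^ 2 * l ^ 2 / d)]
  rw [h2, h1]
  have h3 := mul_le_mul_of_nonneg_left hE (by positivity : 0 ≤ 4 * h)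
  have h4 : 2 * h ^ 2 * l ^ 2 / d = 2 * l ^ 2 / d * h ^ 2 := by ring
  linarith

theorem remainder_mem (hY : Y ∈ S.H) (a b l : ℝ) :
    (fun ω => a + b * max (|Y ω| - l) 0) ∈ S.H :=
  S.affine_mem (S.tail_mem hY l) a b

/-- The linear term of an expansion can have either sign, so both one-sided means are needed. -/
theorem expect_mul_nonneg (hY : Y ∈ S.H) (h1 : 0 ≤ S.E Y) (h2 : 0 ≤ S.E (-Y)) (r : ℝ) :
    0 ≤ S.E (fun ω => r * Y ω) := by
  rcases le_total 0 r with hr | hr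
  · rw [S.expect_mul_of_nonneg hY hr]
    positivity
  · have := S.expect_mul_of_nonneg (S.H.neg_mem hY) (neg_nonneg.2 hr)
    simp only [Pi.neg_apply, neg_mul_neg] at this
    rw [this]
    exact mul_nonneg (neg_nonneg.2 hr) h2

/-! ### The three estimates, centred at zero -/

theorem isLip_smoothPosPart (d : ℝ) : IsLip (fun x => (x + smoothAbs d x) / 2) := by
  have := isLip_const_smul (1 / 2) (isLip_add (isLip_affine 0 1) (isLip_smoothAbs d))
  convert this using 2
  simp
  ring

theorem IsDoubling.expect_posPart_nonpos (hd : S.IsDoubling Y) (hY : Y ∈ S.H)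
    (ht : S.HasSmallTails Y) (h0 : S.E Y ≤ 0) : S.E (fun ω => max (Y ω) 0) ≤ 0 := by
  refine le_of_forall_pos_le_add fun d hd0 => ?_
  have hf := isLip_smoothPosPart d
  have key : S.E (fun ω => (Y ω + smoothAbs d (Y ω)) / 2) ≤ (0 + smoothAbs d 0) / 2 := by
    refine hd.expect_le hY hf fun ε hε => ?_
    -- Tolerance `2ε`, because the smoothed positive part carries only half of the remainder.
    obtain ⟨l, C, hr⟩ := ht.expect_remainder_le hY d (mul_pos two_pos hε)
    refine ⟨C / 2, fun h hh x => ?_⟩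
    -- The derivative of the smoothed positive part; being nonnegative, it allows `E[hpY] = hp E[Y]
    -- ≤ 0`.
    set p : ℝ := (1 + x / smoothAbs d x) / 2 with hp
    have hp0 : 0 ≤ h * p := by
      have := (abs_le.1 (abs_div_smoothAbs_le_one hd0 x)).1
      exact mul_nonneg hh (by linarith)
    have hR := remainder_mem hY (2 * h ^ 2 * l ^ 2 / d) (4 * h) l
    have hR2 := S.H.smul_mem (1 / 2) hR
    have hL := S.H.smul_mem (h * p) hY
    have hc := S.const_mem ((x + smoothAbs d x) / 2)
    have h1 := S.mono _ (S.H.add_mem (S.H.add_mem hL hR2) hc) _ (shift_mem hY hf x h) fun ω => by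
      have := smoothAbs_add_mul_le (l := l) hd0 hh x (Y ω)
      simp only [Pi.add_apply, Pi.smul_apply, smul_eq_mul, hp]
      linarith
    have h2 := S.subadd _ hL _ hR2
    have h3 := S.expect_add_const (S.H.add_mem hL hR2) ((x + smoothAbs d x) / 2)
    rw [S.pos_homog _ hY _ hp0, S.pos_homog _ hR _ (by norm_num)] at h2
    have h4 := hr h hh
    have h5 : h * p * S.E Y ≤ 0 := mul_nonpos_of_nonneg_of_nonpos hp0 h0
    change _ ≤ S.E (fun ω => ((h * p) • Y + _) ω + _) at h1
    rw [h3] at h1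
    linarith
  rw [smoothAbs_zero hd0.le] at key
  have hm := S.mono _ (S.comp_mem_one hY hf) _ (S.comp_mem_one hY (isLip_posPart_sub 0)) fun ω => by
    have := abs_le.1 (abs_le_smoothAbs d (Y ω))
    exact max_le (by linarith) (by linarith)
  simp only [sub_zero] at hm
  linarith

theorem IsDoubling.expect_neg_abs_nonneg (hd : S.IsDoubling Y) (hY : Y ∈ S.H)
    (ht : S.HasSmallTails Y) (h0 : 0 ≤ S.E Y) (h0' : 0 ≤ S.E (-Y)) :
    0 ≤ S.E (fun ω => -|Y ω|) := by
  refine le_of_forall_pos_le_add fun d hd0 => ?_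
  have hf : IsLip (fun x => -smoothAbs d x) := by
    have := isLip_const_smul (-1) (isLip_smoothAbs d)
    convert this using 2
    simp
  have key : -smoothAbs d 0 ≤ S.E (fun ω => -smoothAbs d (Y ω)) := by
    refine hd.le_expect hY hf fun ε hε => ?_
    obtain ⟨l, C, hr⟩ := ht.expect_remainder_le hY d hε
    refine ⟨C, fun h hh x => ?_⟩
    set p : ℝ := x / smoothAbs d x with hp
    have hR := remainder_mem hY (2 * h ^ 2 * l ^ 2 / d) (4 * h) l
    have hS := shift_mem hY hf x h
    have hc := S.const_mem (smoothAbs d x)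
    -- The expansion is solved for the linear term, so that sub-additivity yields a lower bound for
    -- `E[f(x + hY)]`.
    have h1 := S.mono _ (S.H.add_mem (S.H.add_mem hS hR) hc) _
      (S.H.smul_mem (-(h * p)) hY) fun ω => by
        have := smoothAbs_add_mul_le (l := l) hd0 hh x (Y ω)
        simp only [Pi.add_apply, Pi.smul_apply, smul_eq_mul, hp]
        linarith
    have h2 := S.subadd _ hS _ hR
    have h3 := S.expect_add_const (S.H.add_mem hS hR) (smoothAbs d x)
    have h4 := hr h hh
    have h5 : 0 ≤ S.E (-(h * p) • Y) := expect_mul_nonneg hY h0 h0' _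
    change _ ≤ S.E (fun ω => (_ + _ : Ω → ℝ) ω + smoothAbs d x) at h1
    rw [h3] at h1
    linarith
  rw [smoothAbs_zero hd0.le] at key
  have habs : (fun ω => -|Y ω|) ∈ S.H := by
    have := S.H.neg_mem (S.comp_mem_one hY (isLip_abs_sub 0))
    simpa [Pi.neg_def] using this
  have hm := S.mono _ habs _ (S.comp_mem_one hY hf) fun ω => neg_le_neg (abs_le_smoothAbs d (Y ω))
  linarith

end Iteration

/-! ### Doubling is equivalent to maximality -/

theorem IsDoubling.maximallyDistributed {S : SublinearExpectationSpace Ω} {X : Ω → ℝ}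
    (hd : S.IsDoubling X) (hX : X ∈ S.H) (ht : S.HasSmallTails X) : S.MaximallyDistributed X := by
  set b := S.E X with hb
  set a := -S.E (-X) with ha
  have hab : a ≤ b := by linarith [S.expect_neg_add_nonneg hX]
  have upper : S.E (fun ω => max (X ω - b) 0) ≤ 0 := by
    refine (hd.sub_const b).expect_posPart_nonpos (S.H.sub_mem hX (S.const_mem b))
      (ht.sub_const hX b) ?_
    have := S.expect_add_const hX (-b)
    simp only [← sub_eq_add_neg] at this
    linarith
  have lower : S.E (fun ω => max ((-X) ω - -a) 0) ≤ 0 := by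
    have hX' := S.H.neg_mem hX
    refine (hd.neg.sub_const (-a)).expect_posPart_nonpos (S.H.sub_mem hX' (S.const_mem (-a)))
      (ht.neg.sub_const hX' (-a)) ?_
    have := S.expect_add_const hX' (- -a)
    simp only [← sub_eq_add_neg] at this
    linarith
  have point : ∀ y ∈ Set.Icc a b, 0 ≤ S.E (fun ω => -|X ω - y|) := by
    intro y hy
    refine (hd.sub_const y).expect_neg_abs_nonneg (S.H.sub_mem hX (S.const_mem y))
      (ht.sub_const hX y) ?_ ?_
    · have := S.expect_add_const hX (-y)
      simp only [← sub_eq_add_neg] at this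
      linarith [hy.2]
    · have := S.expect_add_const (S.H.neg_mem hX) y
      have h2 : (-fun ω => X ω - y) = fun ω => (-X) ω + y := by
        ext ω
        simp only [Pi.neg_apply]
        ring
      rw [h2, this]
      linarith [hy.1]
  refine ⟨Set.Icc a b, Metric.isBounded_Icc a b, isClosed_Icc, convex_Icc a b, fun φ hφ => ?_⟩
  obtain ⟨K, hK0, hK⟩ := hφ.exists_abs_sub_le
  have hcont : Continuous φ := by
    obtain ⟨L, hL⟩ := hφ
    exact hL.continuous
  obtain ⟨x, hx, hmax⟩ := isCompact_Icc.exists_isMaxOn (Set.nonempty_Icc.2 hab) hcont.continuousOn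
  have hφX := S.comp_mem_one hX hφ
  have le : S.E (fun ω => φ (X ω)) ≤ φ x := by
    have m1 := S.comp_mem_one hX (isLip_posPart_sub b)
    have m2 := S.comp_mem_one (S.H.neg_mem hX) (isLip_posPart_sub (-a))
    have m := S.H.smul_mem K (S.H.add_mem m1 m2)
    have h1 := S.mono _ (S.H.add_mem m (S.const_mem (φ x))) _ hφX fun ω => by
      simp only [Pi.add_apply, Pi.smul_apply, smul_eq_mul, Pi.neg_apply]
      -- `max a (min b (X ω))` is the projection of `X ω` onto `[a, b]`.
      have h2 : φ (max a (min b (X ω))) ≤ φ x :=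
        hmax ⟨le_max_left _ _, max_le hab (min_le_left _ _)⟩
      have h3 := (abs_le.1 (hK (X ω) (max a (min b (X ω))))).2
      have h4 : |X ω - max a (min b (X ω))| ≤ max (X ω - b) 0 + max (-X ω - -a) 0 := by
        rcases le_total (X ω) a with h | h
        · rw [min_eq_right (h.trans hab), max_eq_left h, abs_of_nonpos (by linarith)]
          linarith [le_max_right (X ω - b) 0, le_max_left (-X ω - -a) 0]
        · rcases le_total (X ω) b with h' | h'
          · rw [min_eq_right h', max_eq_right h, sub_self, abs_zero]
            positivity
          · rw [min_eq_left h', max_eq_right hab, abs_of_nonneg (by linarith)]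
            linarith [le_max_left (X ω - b) 0, le_max_right (-X ω - -a) 0]
      have h5 := mul_le_mul_of_nonneg_left h4 hK0
      linarith
    have h2 := S.expect_add_const m (φ x)
    have h3 := S.pos_homog _ (S.H.add_mem m1 m2) K hK0
    have h4 := S.subadd _ m1 _ m2
    have h5 := mul_nonpos_of_nonneg_of_nonpos hK0 (h4.trans (add_nonpos upper lower))
    exact h1.trans (h2.le.trans (by linarith))
  have ge : φ x ≤ S.E (fun ω => φ (X ω)) := by
    have m1 : (fun ω => -|X ω - x|) ∈ S.H := S.H.neg_mem (S.comp_mem_one hX (isLip_abs_sub x))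
    have m := S.H.smul_mem K m1
    have h1 := S.mono _ hφX _ (S.H.add_mem m (S.const_mem (φ x))) fun ω => by
      simp only [Pi.add_apply, Pi.smul_apply, smul_eq_mul]
      linarith [(abs_le.1 (hK (X ω) x)).1]
    have h2 := S.expect_add_const m (φ x)
    have h3 := S.pos_homog _ m1 K hK0
    have h5 := mul_nonneg hK0 (point x hx)
    exact le_trans (by linarith) (h2.symm.le.trans h1)
  have heq := le_antisymm le ge
  refine ⟨⟨x, hx, heq.symm⟩, ?_⟩
  rintro _ ⟨y, hy, rfl⟩
  rw [heq]
  exact hmax hy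

theorem IsIndepCopy.expect_add {S : SublinearExpectationSpace Ω} {X Y : Ω → ℝ}
    (h : S.IsIndepCopy Y X) {φ : ℝ → ℝ} (hφ : IsLip φ) :
    S.E (fun ω => φ (X ω + Y ω)) = S.E (fun ω => S.E (fun ω' => φ (X ω + X ω'))) := by
  rw [h.1 _ (hφ.comp isLip_add_prod)]
  congr 1
  ext ω
  have := h.2 _ (hφ.comp (isLip_affine (X ω) 1))
  simpa using this

theorem MaximallyDistributed.isDoubling {S : SublinearExpectationSpace Ω} {X : Ω → ℝ}
    (hX : X ∈ S.H) (h : S.MaximallyDistributed X) : S.IsDoubling X := fun φ hφ => by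
  obtain ⟨Λ, -, -, hconv, hΛ⟩ := h
  have hs : ∀ x, IsGreatest ((fun y => φ (x + y)) '' Λ) (S.E (fun ω => φ (x + X ω))) := fun x => by
    have := hΛ _ (hφ.comp (isLip_affine x 1))
    simpa using this
  have hlip := S.isLip_section hX (hφ.comp isLip_add_prod)
  obtain ⟨⟨x, hx, hxe⟩, hxu⟩ := hΛ _ hlip
  obtain ⟨⟨z, hz, hze⟩, hzu⟩ := hΛ _ (hφ.comp (isLip_affine 0 2))
  simp only [zero_add] at hze hzu
  refine le_antisymm ?_ ?_
  · obtain ⟨y, hy, hye⟩ := (hs x).1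
    rw [← hxe]
    change S.E (fun ω => φ (x + X ω)) ≤ _
    rw [← hye]
    -- Convexity enters here: `x + y` is twice the midpoint, which lies in `Λ`.
    refine hzu ⟨(1 / 2 : ℝ) • x + (1 / 2 : ℝ) • y, hconv hx hy (by norm_num) (by norm_num)
      (by norm_num), ?_⟩
    simp only [smul_eq_mul]
    congr 1
    ring
  · rw [← hze]
    -- The diagonal choice `x = y = z` gives the reverse inequality.
    exact le_trans ((hs z).2 ⟨z, hz, by simp only [two_mul]⟩) (hxu ⟨z, hz, rfl⟩)

theorem IsIndepCopy.maximallyDistributed_iff {S : SublinearExpectationSpace Ω} {X Y : Ω → ℝ}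
    (hX : X ∈ S.H) (ht : S.HasSmallTails X) (h : S.IsIndepCopy Y X) :
    S.MaximallyDistributed X ↔ S.IdentDistrib (X + Y) S ((2 : ℝ) • X) := by
  have key : S.IdentDistrib (X + Y) S ((2 : ℝ) • X) ↔ S.IsDoubling X :=
    forall₂_congr fun φ hφ => by
      rw [← h.expect_add hφ]
      rfl
  rw [key]
  exact ⟨fun hm => hm.isDoubling hX, fun hd => hd.maximallyDistributed hX ht⟩

theorem IdentDistrib.hasSmallTails {S : SublinearExpectationSpace Ω}
    {S' : SublinearExpectationSpace Ω'} {X : Ω → ℝ} {Y : Ω' → ℝ} (h : S.IdentDistrib X S' Y)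
    (hY : S'.HasSmallTails Y) : S.HasSmallTails X := fun ε hε => by
  obtain ⟨l, hE⟩ := hY ε hε
  have := h _ ((isLip_posPart_sub l).comp (isLip_abs_sub 0))
  simp only [sub_zero] at this
  exact ⟨l, this.trans_le hE⟩

theorem IdentDistrib.maximallyDistributed_iff {S : SublinearExpectationSpace Ω}
    {S' : SublinearExpectationSpace Ω'} {X : Ω → ℝ} {Y : Ω' → ℝ} (h : S.IdentDistrib X S' Y) :
    S.MaximallyDistributed X ↔ S'.MaximallyDistributed Y := by
  unfold MaximallyDistributed
  refine exists_congr fun Λ => and_congr_right' (and_congr_right' (and_congr_right' ?_))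
  exact forall₂_congr fun φ hφ => by rw [h φ hφ]

theorem IdentDistrib.two_smul {S : SublinearExpectationSpace Ω}
    {S' : SublinearExpectationSpace Ω'} {X : Ω → ℝ} {Y : Ω' → ℝ} (h : S.IdentDistrib X S' Y) :
    S.IdentDistrib ((2 : ℝ) • X) S' ((2 : ℝ) • Y) := fun φ hφ => by
  have := h _ (hφ.comp (isLip_affine 0 2))
  simpa using this

/-! ### Existence of an independent copy -/

/-- The law of two independent copies of `X`, on the space of Lipschitz functions on `ℝ × ℝ`. -/
def productSpace (S : SublinearExpectationSpace Ω) (X : Ω → ℝ) (hX : X ∈ S.H) :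
    SublinearExpectationSpace (ℝ × ℝ) where
  H :=
    { carrier := {f | IsLip f}
      add_mem' := isLip_add
      zero_mem' := ⟨0, LipschitzWith.const 0⟩
      smul_mem' := fun r _ hf => isLip_const_smul r hf }
  comp_mem := fun _ _ hf _ hφ => IsLip.comp hφ (isLip_pi hf)
  E := fun f => S.E (fun ω => S.E (fun ω' => f (X ω, X ω')))
  mono := fun f hf g hg hfg =>
    S.mono _ (S.iterated_mem hX hX hf) _ (S.iterated_mem hX hX hg) fun _ =>
      S.mono _ (S.section_mem hX hf _) _ (S.section_mem hX hg _) fun _ => hfg _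
  const := fun c => by rw [S.const, S.const]
  subadd := fun f hf g hg =>
    (S.mono _ (S.H.add_mem (S.iterated_mem hX hX hf) (S.iterated_mem hX hX hg)) _
      (S.iterated_mem hX hX (isLip_add hf hg)) fun _ =>
        S.subadd _ (S.section_mem hX hf _) _ (S.section_mem hX hg _)).trans
      (S.subadd _ (S.iterated_mem hX hX hf) _ (S.iterated_mem hX hX hg))
  pos_homog := fun f hf r hr => by
    rw [← S.pos_homog _ (S.iterated_mem hX hX hf) r hr]
    congr 1
    ext ω
    exact S.pos_homog _ (S.section_mem hX hf _) r hr

theorem productSpace_identDistrib_fst (S : SublinearExpectationSpace Ω) (X : Ω → ℝ)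
    (hX : X ∈ S.H) : (S.productSpace X hX).IdentDistrib Prod.fst S X := fun φ _ => by
  change S.E (fun ω => S.E (fun _ => φ (X ω))) = _
  simp only [S.const]

/-- The product expectation is already iterated; any integration over an absent variable collapses
because constants are preserved. -/
theorem productSpace_isIndepCopy (S : SublinearExpectationSpace Ω) (X : Ω → ℝ) (hX : X ∈ S.H) :
    (S.productSpace X hX).IsIndepCopy Prod.snd Prod.fst := by
  constructor
  · intro φ _
    change S.E (fun ω => S.E (fun ω' => φ (X ω, X ω'))) =
      S.E (fun ω => S.E (fun _ => S.E (fun _ => S.E (fun ω' => φ (X ω, X ω')))))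
    simp only [S.const]
  · intro φ _
    change S.E (fun _ => S.E (fun ω' => φ (X ω'))) = S.E (fun ω => S.E (fun _ => φ (X ω)))
    simp only [S.const]

end SublinearExpectationSpace

theorem mainTheorem5 {Ω : Type*} (S : SublinearExpectationSpace Ω) (X : Ω → ℝ)
    (hX : X ∈ S.H) (hUI : S.UniformlyIntegrable X) :
    -- an independent copy always exists, on a sublinear expectation space over `ℝ × ℝ`
    (∃ (S₁ : SublinearExpectationSpace (ℝ × ℝ)) (X₁ Xbar : ℝ × ℝ → ℝ),
      X₁ ∈ S₁.H ∧ Xbar ∈ S₁.H ∧ S₁.IdentDistrib X₁ S X ∧ S₁.IsIndepCopy Xbar X₁) ∧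
    -- the equivalence, when `Xbar` is an independent copy of `X` on the same space
    (∀ Xbar ∈ S.H, S.IsIndepCopy Xbar X →
      (S.MaximallyDistributed X ↔ S.IdentDistrib (X + Xbar) S ((2 : ℝ) • X))) ∧
    -- the equivalence, when the independent copy lives on another space
    (∀ (Ω₁ : Type*) (S₁ : SublinearExpectationSpace Ω₁), ∀ X₁ ∈ S₁.H, ∀ Xbar ∈ S₁.H,
      S₁.IdentDistrib X₁ S X → S₁.IsIndepCopy Xbar X₁ →
      (S.MaximallyDistributed X ↔ S₁.IdentDistrib (X₁ + Xbar) S ((2 : ℝ) • X))) := by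
  refine ⟨⟨S.productSpace X hX, Prod.fst, Prod.snd, isLip_fst, isLip_snd,
    S.productSpace_identDistrib_fst X hX, S.productSpace_isIndepCopy X hX⟩,
    fun Xbar _ hc => hc.maximallyDistributed_iff hX hUI.hasSmallTails,
    fun Ω₁ S₁ X₁ hX₁ Xbar _ hid hc => ?_⟩
  rw [← hid.maximallyDistributed_iff,
    hc.maximallyDistributed_iff hX₁ (hid.hasSmallTails hUI.hasSmallTails)]
  exact forall₂_congr fun φ hφ => by rw [hid.two_smul φ hφ]
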